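/- Let $n\in\mathbb N$ and let $\theta$ be a real skew-symmetric $n\times n$-matrix. The quantum torus $\mathbb A^n_\theta$ is the universal unital C$^*$-algebra generated by unitaries $u_1,\dots,u_n$ subject to $u_ku_\ell=\exp(2\pi i\,\theta_{k\ell})\,u_\ell u_k$ for $1\le k,\ell\le n$, and its gauge action $\gamma$ of $\mathbb R^n$ is given by $\gamma_s(u_k)=\exp(2\pi i\,s_k)\,u_k$ for $s\in\mathbb R^n$. Call $\theta$ quite irrational if the only $\lambda\in\mathbb Z^n$ with $\exp(2\pi i\langle\lambda,\theta\mu\rangle)=1$ for all $\mu\in\mathbb Z^n$ is $\lambda=0$. A C$^*$-dynamical system $(\mathcal A,G,\alpha)$ consists of a unital C$^*$-algebra $\mathcal A$, a topological group $G$ and an action $\alpha$ of $G$ on $\mathcal A$ by $*$-automorphisms such that $(g,a)\mapsto\alpha_g(a)$ is continuous; it is ergodic if every $a\in\mathcal A$ with $\alpha_g(a)=a$ for all $g\in G$ is a multiple of $1$. Two systems $(\mathcal A,G,\alpha)$ and $(\mathcal A',G',\alpha')$ are equivalent if there are a $*$-isomorphism $\Phi:\mathcal A\to\mathcal A'$ and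 an isomorphism of topological groups $\varphi:G\to G'$ with $\Phi\circ\alpha_g=\alpha'_{\varphi(g)}\circ\Phi$ for all $g\in G$. For a unital C$^*$-algebra $\mathcal A$ containing $\mathbb A^n_\theta$ (with the same unit), a C$^*$-dynamical system $(\mathcal A,\mathbb R^n,\beta)$ is a lift of the gauge action if $\mathbb R^n/\ker\beta$ is compact, where $\ker\beta=\{s\in\mathbb R^n:\beta_s=\mathrm{id}\}$, and $\beta_s(x)=\gamma_s(x)$ for all $s\in\mathbb R^n$ and $x\in\mathbb A^n_\theta$. Let $\theta$ be quite irrational and let $(\mathcal A,\mathbb R^n,\beta)$ be an ergodic lift of the gauge action with $\ker\beta=M\cdot\mathbb Z^n$ for some integer $n\times n$-matrix $M$ with $\det M\neq0$. Then there is a real skew-symmetric $n\times n$-matrix $\theta'$ with $M\theta'M^T\in\theta+M_n(\mathbb Z)$ such that $(\mathcal A,\mathbb R^n,\beta)$ is equivalent to $(\mathbb A^n_{\theta'},\mathbb R^n,\gamma')$, where $\gamma'$ is the gauge action of $\mathbb R^n$ on $\mathbb A^n_{\theta'}$. -/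

import Mathlib

open scoped Matrix

noncomputable section

/-! ## The quantum torus as a universal C⋆-algebra -/

/-- The group algebra `ℂ[F_n]` of the free group on `n` letters: the free unital ⋆-algebra on `n`
unitaries. (The matrix `θ` is only a label; it enters through the seminorm below.) -/
def PreTorus {n : ℕ} (_θ : Matrix (Fin n) (Fin n) ℝ) : Type :=
  MonoidAlgebra ℂ (FreeGroup (Fin n))

namespace PreTorus

variable {n : ℕ} {θ : Matrix (Fin n) (Fin n) ℝ}

instance : Ring (PreTorus θ) := inferInstanceAs (Ring (MonoidAlgebra ℂ (FreeGroup (Fin n))))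

instance : Algebra ℂ (PreTorus θ) :=
  inferInstanceAs (Algebra ℂ (MonoidAlgebra ℂ (FreeGroup (Fin n))))

/-- The group element `w`, as an element of the group algebra. -/
def word (θ : Matrix (Fin n) (Fin n) ℝ) : FreeGroup (Fin n) →* PreTorus θ :=
  MonoidAlgebra.of ℂ (FreeGroup (Fin n))

theorem induction {motive : PreTorus θ → Prop} (x : PreTorus θ)
    (word : ∀ w, motive (word θ w)) (add : ∀ x y, motive x → motive y → motive (x + y))
    (smul : ∀ (c : ℂ) x, motive x → motive (c • x)) : motive x :=
  MonoidAlgebra.induction_on (motive := motive) x word add smul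

/-- Universal property of the group algebra. -/
def liftHom {B : Type*} [Semiring B] [Algebra ℂ B] (f : FreeGroup (Fin n) →* B) :
    PreTorus θ →ₐ[ℂ] B :=
  MonoidAlgebra.lift ℂ B (FreeGroup (Fin n)) f

@[simp] theorem liftHom_word {B : Type*} [Semiring B] [Algebra ℂ B]
    (f : FreeGroup (Fin n) →* B) (w : FreeGroup (Fin n)) :
    liftHom (θ := θ) f (word θ w) = f w :=
  MonoidAlgebra.lift_of f w

/-- The involution `(∑ c_w w)⋆ = ∑ conj c_w w⁻¹`. -/
def starAux (x : PreTorus θ) : PreTorus θ :=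
  Finsupp.sum (MonoidAlgebra.coeff x) fun w c => (starRingEnd ℂ c) • word θ w⁻¹

theorem starAux_add (x y : PreTorus θ) : starAux (x + y) = starAux x + starAux y := by
  unfold starAux
  exact Finsupp.sum_add_index' (by simp) (by intro w a b; rw [map_add, add_smul])

theorem starAux_smul (c : ℂ) (x : PreTorus θ) :
    starAux (c • x) = (starRingEnd ℂ c) • starAux x := by
  unfold starAux
  rw [Finsupp.smul_sum]
  refine (Finsupp.sum_smul_index' (by simp)).trans ?_
  simp only [smul_eq_mul, map_mul, mul_smul]
  rfl

theorem starAux_word (w : FreeGroup (Fin n)) : starAux (word θ w) = word θ w⁻¹ := by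
  unfold starAux
  refine (Finsupp.sum_single_index (by simp)).trans ?_
  simp

instance : StarRing (PreTorus θ) where
  star := starAux
  star_involutive x := by
    induction x using induction with
    | word w => simp [starAux_word]
    | add x y hx hy => rw [starAux_add, starAux_add, hx, hy]
    | smul c x hx => rw [starAux_smul, starAux_smul, hx]; simp
  star_mul x y := by
    change starAux (x * y) = starAux y * starAux x
    induction x using induction with
    | word w =>
      induction y using induction with
      | word v => rw [← map_mul, starAux_word, starAux_word, starAux_word, ← map_mul, mul_inv_rev]
      | add x y hx hy => rw [mul_add, starAux_add, starAux_add, add_mul, hx, hy]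
      | smul c x hx => rw [mul_smul_comm, starAux_smul, starAux_smul, smul_mul_assoc, hx]
    | add x y hx hy => rw [add_mul, starAux_add, starAux_add, mul_add, hx, hy]
    | smul c x hx => rw [smul_mul_assoc, starAux_smul, starAux_smul, mul_smul_comm, hx]
  star_add := starAux_add

@[simp] theorem star_word (w : FreeGroup (Fin n)) : star (word θ w) = word θ w⁻¹ :=
  starAux_word w

instance : StarModule ℂ (PreTorus θ) where
  star_smul := starAux_smul

/-- The free unitary generators. -/
def gen (θ : Matrix (Fin n) (Fin n) ℝ) (k : Fin n) : PreTorus θ := word θ (FreeGroup.of k)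

/-- C⋆-seminorms on `ℂ[F_n]` that respect the relations `u_k u_l = exp(2πi θ_kl) u_l u_k`. -/
structure IsTorusSeminorm (θ : Matrix (Fin n) (Fin n) ℝ) (p : Seminorm ℂ (PreTorus θ)) :
    Prop where
  mul_le : ∀ x y, p (x * y) ≤ p x * p y
  star_mul_self : ∀ x, p (star x * x) = p x ^ 2
  rel : ∀ k l, p (gen θ k * gen θ l -
    Complex.exp (2 * Real.pi * Complex.I * (θ k l : ℂ)) • (gen θ l * gen θ k)) = 0

namespace IsTorusSeminorm

variable {p : Seminorm ℂ (PreTorus θ)}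

theorem word_le_one (hp : IsTorusSeminorm θ p) (w : FreeGroup (Fin n)) : p (word θ w) ≤ 1 := by
  have h1 : p 1 ≤ 1 := by
    have := hp.star_mul_self 1
    simp only [star_one, mul_one] at this
    nlinarith [apply_nonneg p (1 : PreTorus θ)]
  have := hp.star_mul_self (word θ w)
  rw [star_word, ← map_mul, inv_mul_cancel, map_one] at this
  nlinarith [apply_nonneg p (word θ w)]

theorem star_le (hp : IsTorusSeminorm θ p) (x : PreTorus θ) : p x ≤ p (star x) := by
  have h := hp.star_mul_self x
  have h2 := hp.mul_le (star x) x
  rcases (apply_nonneg p x).eq_or_lt with h0 | h0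
  · rw [← h0]; exact apply_nonneg _ _
  · nlinarith

theorem map_star (hp : IsTorusSeminorm θ p) (x : PreTorus θ) : p (star x) = p x :=
  le_antisymm (by simpa using hp.star_le (star x)) (hp.star_le x)

end IsTorusSeminorm

theorem isTorusSeminorm_zero : IsTorusSeminorm θ 0 :=
  ⟨by simp, by simp, by simp⟩

instance : Nonempty {p : Seminorm ℂ (PreTorus θ) // IsTorusSeminorm θ p} :=
  ⟨⟨0, isTorusSeminorm_zero⟩⟩

/-- The universal (largest) C⋆-seminorm compatible with the relations. -/
instance : Norm (PreTorus θ) where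
  norm x := ⨆ p : {p : Seminorm ℂ (PreTorus θ) // IsTorusSeminorm θ p}, p.1 x

theorem norm_def (x : PreTorus θ) :
    ‖x‖ = ⨆ p : {p : Seminorm ℂ (PreTorus θ) // IsTorusSeminorm θ p}, p.1 x := rfl

theorem bddAbove (x : PreTorus θ) : BddAbove (Set.range
    fun p : {p : Seminorm ℂ (PreTorus θ) // IsTorusSeminorm θ p} => p.1 x) := by
  suffices h : ∃ C, ∀ p : {p : Seminorm ℂ (PreTorus θ) // IsTorusSeminorm θ p}, p.1 x ≤ C by
    obtain ⟨C, hC⟩ := h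
    exact ⟨C, by rintro _ ⟨p, rfl⟩; exact hC p⟩
  induction x using induction with
  | word w => exact ⟨1, fun p => p.2.word_le_one w⟩
  | add x y hx hy =>
    obtain ⟨C, hC⟩ := hx
    obtain ⟨D, hD⟩ := hy
    exact ⟨C + D, fun p => (map_add_le_add p.1 x y).trans (add_le_add (hC p) (hD p))⟩
  | smul c x hx =>
    obtain ⟨C, hC⟩ := hx
    exact ⟨‖c‖ * C, fun p => by
      rw [map_smul_eq_mul]; exact mul_le_mul_of_nonneg_left (hC p) (norm_nonneg c)⟩

theorem le_norm {p : Seminorm ℂ (PreTorus θ)} (hp : IsTorusSeminorm θ p) (x : PreTorus θ) :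
    p x ≤ ‖x‖ :=
  le_ciSup (bddAbove x) ⟨p, hp⟩

theorem norm_nonneg' (x : PreTorus θ) : 0 ≤ ‖x‖ := Real.iSup_nonneg fun p => apply_nonneg p.1 x

theorem norm_smul' (c : ℂ) (x : PreTorus θ) : ‖c • x‖ = ‖c‖ * ‖x‖ := by
  simp only [norm_def, map_smul_eq_mul]
  exact (Real.mul_iSup_of_nonneg (norm_nonneg c) _).symm

instance : SeminormedAddCommGroup (PreTorus θ) :=
  SeminormedAddCommGroup.ofCore (𝕜 := ℂ) (E := PreTorus θ)
    { norm_nonneg := norm_nonneg'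
      norm_smul := norm_smul'
      norm_triangle := fun x y => ciSup_le fun p =>
        (map_add_le_add p.1 x y).trans (add_le_add (le_norm p.2 x) (le_norm p.2 y)) }

instance : SeminormedRing (PreTorus θ) where
  __ := (inferInstance : SeminormedAddCommGroup (PreTorus θ))
  __ := (inferInstance : Ring (PreTorus θ))
  norm_mul_le x y := ciSup_le fun p =>
    (p.2.mul_le x y).trans
      (mul_le_mul (le_norm p.2 x) (le_norm p.2 y) (apply_nonneg _ _) (norm_nonneg' x))

instance : NormedAlgebra ℂ (PreTorus θ) where
  norm_smul_le c x := (norm_smul' c x).le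

theorem norm_star' (x : PreTorus θ) : ‖star x‖ = ‖x‖ := by
  simp only [norm_def]
  exact iSup_congr fun p => p.2.map_star x

theorem sq_norm_le (x : PreTorus θ) : ‖x‖ * ‖x‖ ≤ ‖star x * x‖ := by
  have h : ‖x‖ ≤ Real.sqrt ‖star x * x‖ := ciSup_le fun p => by
    apply Real.le_sqrt_of_sq_le
    rw [← p.2.star_mul_self]
    exact le_norm p.2 _
  calc ‖x‖ * ‖x‖ ≤ Real.sqrt ‖star x * x‖ * Real.sqrt ‖star x * x‖ :=
        mul_self_le_mul_self (norm_nonneg' x) h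
    _ = _ := Real.mul_self_sqrt (norm_nonneg' _)

theorem norm_rel (k l : Fin n) : ‖gen θ k * gen θ l -
    Complex.exp (2 * Real.pi * Complex.I * (θ k l : ℂ)) • (gen θ l * gen θ k)‖ = 0 := by
  rw [norm_def]
  simp only [fun p : {p : Seminorm ℂ (PreTorus θ) // IsTorusSeminorm θ p} => p.2.rel k l]
  exact ciSup_const

end PreTorus

/-- The quantum torus `A_θ`: the universal unital C⋆-algebra generated by unitaries `u_1, …, u_n`
subject to `u_k u_l = exp(2πi θ_kl) u_l u_k`, i.e. the Hausdorff completion of the free ⋆-algebra on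
`n` unitaries in the largest C⋆-seminorm respecting the relations. -/
def QuantumTorus {n : ℕ} (θ : Matrix (Fin n) (Fin n) ℝ) : Type :=
  UniformSpace.Completion (PreTorus θ)

namespace QuantumTorus

open UniformSpace

variable {n : ℕ} {θ : Matrix (Fin n) (Fin n) ℝ}

instance : NormedRing (QuantumTorus θ) := inferInstanceAs (NormedRing (Completion (PreTorus θ)))

instance : NormedAlgebra ℂ (QuantumTorus θ) where
  __ := (inferInstance : Algebra ℂ (Completion (PreTorus θ)))
  norm_smul_le := norm_smul_le (α := ℂ) (β := Completion (PreTorus θ))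

instance : CompleteSpace (QuantumTorus θ) :=
  inferInstanceAs (CompleteSpace (Completion (PreTorus θ)))

/-- The canonical map from the free ⋆-algebra. -/
def incl (θ : Matrix (Fin n) (Fin n) ℝ) : PreTorus θ →ₐ[ℂ] QuantumTorus θ where
  toFun x := (x : Completion (PreTorus θ))
  map_one' := rfl
  map_mul' := Completion.coe_mul
  map_zero' := rfl
  map_add' := Completion.coe_add
  commutes' _ := rfl

theorem norm_incl (x : PreTorus θ) : ‖incl θ x‖ = ‖x‖ := Completion.norm_coe x

theorem continuous_incl : Continuous (incl θ) := Completion.continuous_coe _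

theorem denseRange_incl : DenseRange (incl θ) := Completion.denseRange_coe

theorem uniformContinuous_star : UniformContinuous (star : PreTorus θ → PreTorus θ) :=
  (AddMonoidHomClass.isometry_of_norm (starAddEquiv : PreTorus θ ≃+ PreTorus θ)
    PreTorus.norm_star').uniformContinuous

instance : Star (QuantumTorus θ) where
  star := Completion.map (star : PreTorus θ → PreTorus θ)

theorem continuous_star' : Continuous (star : QuantumTorus θ → QuantumTorus θ) :=
  Completion.continuous_map

theorem star_incl (x : PreTorus θ) : star (incl θ x) = incl θ (star x) :=
  Completion.map_coe uniformContinuous_star x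

instance : StarRing (QuantumTorus θ) where
  star_involutive x := by
    refine denseRange_incl.induction_on (p := fun x => star (star x) = x) x
      (isClosed_eq (continuous_star'.comp continuous_star') continuous_id) fun a => ?_
    rw [star_incl, star_incl, star_star]
  star_mul x y := by
    refine denseRange_incl.induction_on₂ (p := fun x y => star (x * y) = star y * star x) ?_ ?_ x y
    · exact isClosed_eq (continuous_star'.comp continuous_mul)
        ((continuous_star'.comp continuous_snd).mul (continuous_star'.comp continuous_fst))
    · intro a b
      rw [← map_mul, star_incl, star_incl, star_incl, star_mul, map_mul]
  star_add x y := by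
    refine denseRange_incl.induction_on₂ (p := fun x y => star (x + y) = star x + star y) ?_ ?_ x y
    · exact isClosed_eq (continuous_star'.comp continuous_add)
        ((continuous_star'.comp continuous_fst).add (continuous_star'.comp continuous_snd))
    · intro a b
      rw [← map_add, star_incl, star_incl, star_incl, star_add, map_add]

instance : CStarAlgebra (QuantumTorus θ) where
  norm_mul_self_le x := by
    refine denseRange_incl.induction_on (p := fun x => ‖x‖ * ‖x‖ ≤ ‖star x * x‖) x
      (isClosed_le (continuous_norm.mul continuous_norm)
        (continuous_norm.comp (continuous_star'.mul continuous_id))) fun a => ?_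
    rw [star_incl, ← map_mul, norm_incl, norm_incl]
    exact PreTorus.sq_norm_le a
  star_smul c x := by
    refine denseRange_incl.induction_on (p := fun x => star (c • x) = star c • star x) x
      (isClosed_eq (continuous_star'.comp (continuous_const_smul c))
        ((continuous_const_smul (star c)).comp continuous_star')) fun a => ?_
    rw [← map_smul, star_incl, star_incl, star_smul, map_smul]

/-- The canonical generators `u_k` of the quantum torus. -/
def gen (θ : Matrix (Fin n) (Fin n) ℝ) (k : Fin n) : QuantumTorus θ := incl θ (PreTorus.gen θ k)

theorem gen_mem_unitary (k : Fin n) : gen θ k ∈ unitary (QuantumTorus θ) := by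
  constructor <;>
  · unfold gen PreTorus.gen
    rw [star_incl, ← map_mul, PreTorus.star_word, ← map_mul]
    simp

theorem gen_mul_gen (k l : Fin n) : gen θ k * gen θ l =
    Complex.exp (2 * Real.pi * Complex.I * (θ k l : ℂ)) • (gen θ l * gen θ k) := by
  unfold gen
  rw [← sub_eq_zero, ← map_mul, ← map_mul, ← map_smul, ← map_sub, ← norm_eq_zero, norm_incl]
  exact PreTorus.norm_rel k l

/-- The canonical generators, as unitaries. -/
def genU (θ : Matrix (Fin n) (Fin n) ℝ) (k : Fin n) : unitary (QuantumTorus θ) :=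
  ⟨gen θ k, gen_mem_unitary k⟩

theorem continuous_hom {B : Type*} [CStarAlgebra B] (f : QuantumTorus θ →⋆ₐ[ℂ] B) :
    Continuous f :=
  AddMonoidHomClass.continuous_of_bound f 1 fun x => by
    simpa using NonUnitalStarAlgHom.norm_apply_le f x

/-- Two ⋆-homomorphisms that agree on the generators are equal. -/
theorem hom_ext {B : Type*} [CStarAlgebra B] {f g : QuantumTorus θ →⋆ₐ[ℂ] B}
    (h : ∀ k, f (gen θ k) = g (gen θ k)) : f = g := by
  have hw : ∀ w, f (incl θ (PreTorus.word θ w)) = g (incl θ (PreTorus.word θ w)) := by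
    intro w
    induction w using FreeGroup.induction_on with
    | C1 => simp
    | of k => exact h k
    | inv_of k _ =>
      rw [← PreTorus.star_word, ← star_incl, map_star, map_star]
      exact congrArg star (h k)
    | mul x y hx hy => simp only [map_mul, hx, hy]
  ext x
  refine denseRange_incl.induction_on (p := fun x => f x = g x) x
    (isClosed_eq (continuous_hom f) (continuous_hom g)) fun a => ?_
  induction a using PreTorus.induction with
  | word w => exact hw w
  | add x y hx hy => simp only [map_add, hx, hy]
  | smul c x hx => simp only [map_smul, hx]

section lift

variable {B : Type*} [CStarAlgebra B] (v : Fin n → unitary B)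

/-- The map of the free ⋆-algebra given by a tuple of unitaries. -/
def preLift : PreTorus θ →ₐ[ℂ] B :=
  PreTorus.liftHom ((unitary B).subtype.comp (FreeGroup.lift v))

theorem preLift_word (w : FreeGroup (Fin n)) :
    preLift (θ := θ) v (PreTorus.word θ w) = (FreeGroup.lift v w : unitary B) := by
  simp [preLift]

theorem preLift_gen (k : Fin n) : preLift (θ := θ) v (PreTorus.gen θ k) = (v k : B) := by
  simp [PreTorus.gen, preLift_word]

theorem preLift_star (x : PreTorus θ) : preLift v (star x) = star (preLift v x) := by
  induction x using PreTorus.induction with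
  | word w => rw [PreTorus.star_word, preLift_word, preLift_word, map_inv]; rfl
  | add x y hx hy => simp only [star_add, map_add, hx, hy]
  | smul c x hx => simp only [star_smul, map_smul, hx]

theorem isTorusSeminorm_preLift
    (h : ∀ k l, (v k : B) * (v l : B) =
      Complex.exp (2 * Real.pi * Complex.I * (θ k l : ℂ)) • ((v l : B) * (v k : B))) :
    PreTorus.IsTorusSeminorm θ ((normSeminorm ℂ B).comp (preLift (θ := θ) v).toLinearMap) where
  mul_le x y := by simpa using norm_mul_le _ _
  star_mul_self x := by
    simp only [Seminorm.comp_apply, AlgHom.toLinearMap_apply, map_mul, preLift_star,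
      coe_normSeminorm, sq]
    exact CStarRing.norm_star_mul_self
  rel k l := by
    simp only [Seminorm.comp_apply, AlgHom.toLinearMap_apply, map_sub, map_smul, map_mul,
      preLift_gen, coe_normSeminorm, norm_eq_zero]
    exact sub_eq_zero.mpr (h k l)

theorem continuous_preLift
    (h : ∀ k l, (v k : B) * (v l : B) =
      Complex.exp (2 * Real.pi * Complex.I * (θ k l : ℂ)) • ((v l : B) * (v k : B))) : Continuous (preLift (θ := θ) v) :=
  AddMonoidHomClass.continuous_of_bound (preLift (θ := θ) v) 1 fun x => by
    simpa using PreTorus.le_norm (isTorusSeminorm_preLift v h) x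

/-- Universal property: unitaries `v_k` satisfying the relations induce a ⋆-homomorphism
`u_k ↦ v_k`. -/
def lift
    (h : ∀ k l, (v k : B) * (v l : B) =
      Complex.exp (2 * Real.pi * Complex.I * (θ k l : ℂ)) • ((v l : B) * (v k : B))) : QuantumTorus θ →⋆ₐ[ℂ] B :=
  have hc : ∀ x, (Completion.extensionHom (preLift (θ := θ) v).toRingHom (continuous_preLift v h) :
      Completion (PreTorus θ) →+* B) (incl θ x) = preLift v x :=
    fun x => Completion.extensionHom_coe _ (continuous_preLift v h) x
  { (Completion.extensionHom (preLift (θ := θ) v).toRingHom (continuous_preLift v h) :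
      Completion (PreTorus θ) →+* B) with
    commutes' := fun c => by
      have := hc (algebraMap ℂ _ c)
      simpa using this
    map_star' := fun x => by
      refine denseRange_incl.induction_on (p := fun x =>
        Completion.extension (preLift (θ := θ) v) (star x : QuantumTorus θ) =
          star (Completion.extension (preLift (θ := θ) v) x)) x
        (isClosed_eq (Completion.continuous_extension.comp continuous_star')
          (continuous_star.comp Completion.continuous_extension)) fun a => ?_
      rw [star_incl]
      have h1 := hc a
      have h2 := hc (star a)
      rw [preLift_star, ← h1] at h2
      exact h2 }

theorem lift_incl
    (h : ∀ k l, (v k : B) * (v l : B) =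
      Complex.exp (2 * Real.pi * Complex.I * (θ k l : ℂ)) • ((v l : B) * (v k : B)))
    (x : PreTorus θ) : lift v h (incl θ x) = preLift v x :=
  Completion.extensionHom_coe _ (continuous_preLift v h) x

@[simp] theorem lift_gen
    (h : ∀ k l, (v k : B) * (v l : B) =
      Complex.exp (2 * Real.pi * Complex.I * (θ k l : ℂ)) • ((v l : B) * (v k : B)))
    (k : Fin n) : lift v h (gen θ k) = (v k : B) := by
  rw [gen, lift_incl, preLift_gen]

end lift

end QuantumTorus

/-- `θ` is quite irrational if `exp(2πi⟨lam, θ mu⟩) = 1` for all `mu ∈ ℤ^n` forces `lam = 0`. -/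
def QuiteIrrational {n : ℕ} (θ : Matrix (Fin n) (Fin n) ℝ) : Prop :=
  ∀ lam : Fin n → ℤ,
    (∀ mu : Fin n → ℤ, Complex.exp (2 * Real.pi * Complex.I *
      (((fun i => (lam i : ℝ)) ⬝ᵥ (θ *ᵥ fun i => (mu i : ℝ)) : ℝ) : ℂ)) = 1) → lam = 0

/-! ## C⋆-dynamical systems -/

/-- A C⋆-dynamical system `(A, G, α)` with an (additively written) topological group `G`. -/
structure CStarDynamicalSystem (A G : Type*) [CStarAlgebra A] [AddGroup G]
    [TopologicalSpace G] where
  act : G → (A ≃⋆ₐ[ℂ] A)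
  act_zero : ∀ a, act 0 a = a
  act_add : ∀ s t a, act (s + t) a = act s (act t a)
  continuous_act : Continuous fun x : G × A => act x.1 x.2

namespace CStarDynamicalSystem

variable {A G A' G' : Type*} [CStarAlgebra A] [AddGroup G] [TopologicalSpace G]
  [CStarAlgebra A'] [AddGroup G'] [TopologicalSpace G']

/-- The kernel `{s | α_s = id}`. -/
def ker (α : CStarDynamicalSystem A G) : AddSubgroup G where
  carrier := {s | ∀ a, α.act s a = a}
  zero_mem' := α.act_zero
  add_mem' {s t} hs ht a := by rw [α.act_add, ht, hs]
  neg_mem' {s} hs a := by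
    have h := α.act_add (-s) s a
    rw [neg_add_cancel, α.act_zero, hs] at h
    exact h.symm

/-- Ergodicity: the fixed point algebra is `ℂ · 1`. -/
def IsErgodic (α : CStarDynamicalSystem A G) : Prop :=
  ∀ a : A, (∀ s, α.act s a = a) → ∃ c : ℂ, a = algebraMap ℂ A c

/-- Equivalence: a ⋆-isomorphism `Φ` and an isomorphism of topological groups `φ` with
`Φ ∘ α_s = α'_{φ(s)} ∘ Φ`. -/
def Equivalent (α : CStarDynamicalSystem A G) (α' : CStarDynamicalSystem A' G') : Prop :=
  ∃ (Φ : A ≃⋆ₐ[ℂ] A') (φ : G ≃ₜ+ G'), ∀ s a, Φ (α.act s a) = α'.act (φ s) (Φ a)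

end CStarDynamicalSystem

/-! ## The gauge action and its lifts -/

namespace QuantumTorus

variable {n : ℕ} {θ : Matrix (Fin n) (Fin n) ℝ}

/-- The phase `exp(2πi t)`, as a unitary scalar. -/
def phase (t : ℝ) : unitary ℂ :=
  ⟨Complex.exp (2 * Real.pi * Complex.I * (t : ℂ)), by
    have h : star (Complex.exp (2 * Real.pi * Complex.I * (t : ℂ))) *
        Complex.exp (2 * Real.pi * Complex.I * (t : ℂ)) = 1 := by
      rw [Complex.star_def, ← Complex.exp_conj, ← Complex.exp_add, ← Complex.exp_zero]
      congr 1
      simp [Complex.conj_ofNat]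
    exact ⟨h, by rw [mul_comm]; exact h⟩⟩

@[simp] theorem coe_phase (t : ℝ) :
    (phase t : ℂ) = Complex.exp (2 * Real.pi * Complex.I * (t : ℂ)) := rfl

/-- The gauge transformation `u_k ↦ exp(2πi s_k) u_k`. -/
def gaugeHom (θ : Matrix (Fin n) (Fin n) ℝ) (s : Fin n → ℝ) :
    QuantumTorus θ →⋆ₐ[ℂ] QuantumTorus θ :=
  lift (fun k => ⟨(phase (s k) : ℂ) • gen θ k,
      Unitary.smul_mem_of_mem (phase (s k)).2 (gen_mem_unitary k)⟩) fun k l => by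
    simp only [smul_mul_smul_comm]
    rw [gen_mul_gen k l, smul_comm, mul_comm (phase (s k) : ℂ)]

@[simp] theorem gaugeHom_gen (s : Fin n → ℝ) (k : Fin n) : gaugeHom θ s (gen θ k) =
    Complex.exp (2 * Real.pi * Complex.I * (s k : ℂ)) • gen θ k := by
  simp [gaugeHom]

theorem gaugeHom_zero : gaugeHom θ 0 = StarAlgHom.id ℂ (QuantumTorus θ) :=
  hom_ext fun k => by simp

theorem gaugeHom_add (s t : Fin n → ℝ) :
    gaugeHom θ (s + t) = (gaugeHom θ s).comp (gaugeHom θ t) :=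
  hom_ext fun k => by
    simp only [gaugeHom_gen, StarAlgHom.comp_apply, map_smul, smul_smul, Pi.add_apply]
    rw [← Complex.exp_add]
    congr 2
    push_cast
    ring

/-- The gauge transformation as an automorphism. -/
def gaugeEquiv (θ : Matrix (Fin n) (Fin n) ℝ) (s : Fin n → ℝ) :
    QuantumTorus θ ≃⋆ₐ[ℂ] QuantumTorus θ :=
  StarAlgEquiv.ofStarAlgHom (gaugeHom θ s) (gaugeHom θ (-s))
    (by rw [← gaugeHom_add, neg_add_cancel, gaugeHom_zero])
    (by rw [← gaugeHom_add, add_neg_cancel, gaugeHom_zero])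

theorem gaugeEquiv_apply (s : Fin n → ℝ) (x : QuantumTorus θ) :
    gaugeEquiv θ s x = gaugeHom θ s x := rfl

theorem continuous_gaugeHom_apply (x : QuantumTorus θ) :
    Continuous fun s : Fin n → ℝ => gaugeHom θ s x := by
  have hw : ∀ w, Continuous fun s : Fin n → ℝ => gaugeHom θ s (incl θ (PreTorus.word θ w)) := by
    intro w
    induction w using FreeGroup.induction_on with
    | C1 => simpa using continuous_const
    | of k =>
      change Continuous fun s : Fin n → ℝ => gaugeHom θ s (gen θ k)
      simp only [gaugeHom_gen]
      fun_prop
    | inv_of k hk =>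
      simp only [← PreTorus.star_word, ← star_incl, map_star]
      exact continuous_star.comp hk
    | mul x y hx hy => simp only [map_mul]; exact hx.mul hy
  have hd : ∀ a, Continuous fun s : Fin n → ℝ => gaugeHom θ s (incl θ a) := by
    intro a
    induction a using PreTorus.induction with
    | word w => exact hw w
    | add x y hx hy => simp only [map_add]; exact hx.add hy
    | smul c x hx => simp only [map_smul]; exact hx.const_smul c
  refine Metric.continuous_iff'.mpr fun s ε hε => ?_
  obtain ⟨a, ha⟩ := denseRange_incl.exists_dist_lt x (by positivity : 0 < ε / 3)
  filter_upwards [Metric.continuous_iff'.mp (hd a) s (ε / 3) (by positivity)] with t ht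
  have hcontr : ∀ r, dist (gaugeHom θ r x) (gaugeHom θ r (incl θ a)) < ε / 3 := fun r => by
    rw [dist_eq_norm, ← map_sub]
    refine (NonUnitalStarAlgHom.norm_apply_le (gaugeHom θ r) _).trans_lt ?_
    rwa [← dist_eq_norm]
  have h1 := hcontr t
  have h2 := hcontr s
  rw [dist_comm] at h2
  have := dist_triangle4 (gaugeHom θ t x) (gaugeHom θ t (incl θ a)) (gaugeHom θ s (incl θ a))
    (gaugeHom θ s x)
  linarith

/-- The gauge action of `ℝ^n` on the quantum torus, `γ_s(u_k) = exp(2πi s_k) u_k`. -/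
def gauge (θ : Matrix (Fin n) (Fin n) ℝ) : CStarDynamicalSystem (QuantumTorus θ) (Fin n → ℝ) where
  act := gaugeEquiv θ
  act_zero a := by rw [gaugeEquiv_apply, gaugeHom_zero]; rfl
  act_add s t a := by simp only [gaugeEquiv_apply, gaugeHom_add]; rfl
  continuous_act := by
    simp only [gaugeEquiv_apply]
    refine continuous_iff_continuousAt.mpr fun ⟨s, x⟩ => ?_
    refine Metric.continuousAt_iff'.mpr fun ε hε => ?_
    have h1 := Metric.continuous_iff'.mp (continuous_gaugeHom_apply (θ := θ) x) s (ε / 2)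
      (by positivity)
    have h2 := Metric.ball_mem_nhds x (by positivity : 0 < ε / 2)
    rw [nhds_prod_eq]
    filter_upwards [Filter.prod_mem_prod h1 h2] with ⟨t, y⟩ hty
    obtain ⟨ht, hy⟩ := hty
    have hy' : dist (gaugeHom θ t y) (gaugeHom θ t x) < ε / 2 := by
      rw [dist_eq_norm, ← map_sub]
      refine (NonUnitalStarAlgHom.norm_apply_le (gaugeHom θ t) _).trans_lt ?_
      rwa [← dist_eq_norm]
    have ht' : dist (gaugeHom θ t x) (gaugeHom θ s x) < ε / 2 := ht
    have := dist_triangle (gaugeHom θ t y) (gaugeHom θ t x) (gaugeHom θ s x)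
    change dist (gaugeHom θ t y) (gaugeHom θ s x) < ε
    linarith

/-- `(A, ℝ^n, β)` is a lift of the gauge action on `A_θ`, where `A` contains `A_θ` by means of the
injective unital ⋆-homomorphism `ι`: the kernel of `β` is cocompact, and `β` restricts to the gauge
action on `A_θ`. -/
structure IsGaugeLift {A : Type*} [CStarAlgebra A] (ι : QuantumTorus θ →⋆ₐ[ℂ] A)
    (β : CStarDynamicalSystem A (Fin n → ℝ)) : Prop where
  injective : Function.Injective ι
  compact_quotient : CompactSpace ((Fin n → ℝ) ⧸ β.ker)
  act_eq : ∀ s x, β.act s (ι x) = ι ((gauge θ).act s x)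

end QuantumTorus

end

noncomputable section

/-! Substituting `M` into `β` gives an ergodic action `α` of `ℝ^n` whose kernel is exactly `ℤ^n`,
that is, a faithful ergodic action of the torus. Ergodicity forces `a⋆a` and `aa⋆` to be scalar for
every spectral element `a`, so each weight space is zero or is spanned by one unitary
(`exists_unitary`, `exists_eq_smul`). The occurring weights form a subgroup of `ℤ^n`. If it were
proper, a character of the quotient would give a nontrivial point of the torus acting trivially;
hence every `e_k` is the weight of a unitary `v_k` (`exists_unitary_isSpectral`). By ergodicity the
`v_k` commute up to phases, which define a skew-symmetric `θ'`. The universal property yields an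
equivariant map `u_k ↦ v_k`; comparing spectral components on both sides shows that it is bijective
(`liftPhase_bijective`). Finally `ι u_j` has as weight the `j`-th row of `M`, so it is a multiple of
a word in the `v_k` of that degree. Computing the commutation phase of `ι u_k` and `ι u_l` in both
pictures gives the congruence between `M θ' Mᵀ` and `θ`. -/

/-- An integer vector, regarded as a real vector. -/
def intVec {n : ℕ} (ν : Fin n → ℤ) : Fin n → ℝ := fun k => (ν k : ℝ)

section intVec

variable {n : ℕ}

@[simp] theorem intVec_apply (ν : Fin n → ℤ) (k : Fin n) : intVec ν k = (ν k : ℝ) := rfl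

@[simp] theorem intVec_zero : intVec (0 : Fin n → ℤ) = 0 := by ext; simp

@[simp] theorem intVec_add (μ ν : Fin n → ℤ) : intVec (μ + ν) = intVec μ + intVec ν := by
  ext; simp

@[simp] theorem intVec_neg (ν : Fin n → ℤ) : intVec (-ν) = -intVec ν := by ext; simp

@[simp] theorem intVec_single (k : Fin n) : intVec (Pi.single k 1) = Pi.single k 1 := by
  ext j
  by_cases h : j = k
  · subst h; simp
  · simp [h]

end intVec

/-! ### Phases. -/

namespace QuantumTorus

theorem phase_zero : (phase 0 : ℂ) = 1 := by simp

theorem phase_add (s t : ℝ) : (phase (s + t) : ℂ) = phase s * phase t := by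
  simp only [coe_phase, Complex.ofReal_add, mul_add, Complex.exp_add]

theorem phase_neg_mul (t : ℝ) : (phase (-t) : ℂ) * phase t = 1 := by
  rw [← phase_add, neg_add_cancel, phase_zero]

theorem star_phase (t : ℝ) : star (phase t : ℂ) = phase (-t) := by
  have h : (star (phase t : ℂ)) * phase t = 1 := (phase t).2.1
  have h0 : (phase t : ℂ) ≠ 0 := by simp
  exact mul_right_cancel₀ h0 (h.trans (phase_neg_mul t).symm)

theorem phase_eq_one_iff {t : ℝ} : (phase t : ℂ) = 1 ↔ ∃ m : ℤ, t = m := by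
  rw [coe_phase, Complex.exp_eq_one_iff]
  refine exists_congr fun m => ⟨fun h => ?_, fun h => ?_⟩
  · have h2 : (2 * Real.pi * Complex.I : ℂ) ≠ 0 := Complex.two_pi_I_ne_zero
    rw [mul_comm (m : ℂ)] at h
    exact_mod_cast mul_left_cancel₀ h2 h
  · rw [h]; push_cast; ring

theorem phase_half : (phase (1 / 2) : ℂ) = -1 := by
  rw [coe_phase, ← Complex.exp_pi_mul_I]
  congr 1
  push_cast
  ring

/-- Every complex number of norm one is a phase. -/
theorem exists_phase_eq {c : ℂ} (hc : ‖c‖ = 1) : ∃ t : ℝ, (phase t : ℂ) = c := by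
  refine ⟨c.arg / (2 * Real.pi), ?_⟩
  have h := Complex.norm_mul_exp_arg_mul_I c
  rw [hc, Complex.ofReal_one, one_mul] at h
  rw [coe_phase, ← h]
  congr 1
  have : (Real.pi : ℂ) ≠ 0 := by exact_mod_cast Real.pi_ne_zero
  rw [h]
  push_cast
  field_simp

end QuantumTorus

open QuantumTorus

/-! ### Spectral elements of ergodic actions. -/

namespace CStarDynamicalSystem

variable {n : ℕ} {A : Type*} [CStarAlgebra A]

/-- `a` is a spectral element of weight `w` if `α_s(a) = exp(2πi⟨w, s⟩) a` for all `s`. -/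
def IsSpectral (α : CStarDynamicalSystem A (Fin n → ℝ)) (w : Fin n → ℝ) (a : A) : Prop :=
  ∀ s, α.act s a = (phase (w ⬝ᵥ s) : ℂ) • a

namespace IsSpectral

variable {α : CStarDynamicalSystem A (Fin n → ℝ)} {w w' : Fin n → ℝ} {a b : A}

theorem one : α.IsSpectral 0 1 := fun s => by
  rw [map_one, zero_dotProduct, phase_zero, one_smul]

theorem mul (ha : α.IsSpectral w a) (hb : α.IsSpectral w' b) : α.IsSpectral (w + w') (a * b) :=
  fun s => by rw [map_mul, ha, hb, smul_mul_smul_comm, add_dotProduct, phase_add]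

theorem star (ha : α.IsSpectral w a) : α.IsSpectral (-w) (star a) := fun s => by
  rw [map_star, ha, star_smul, star_phase, neg_dotProduct]

theorem smul (ha : α.IsSpectral w a) (c : ℂ) : α.IsSpectral w (c • a) := fun s => by
  rw [map_smul, ha, smul_comm]

/-- In an ergodic system, spectral elements of weight zero are scalar. -/
theorem exists_eq_algebraMap (herg : α.IsErgodic) (ha : α.IsSpectral 0 a) :
    ∃ c : ℂ, a = algebraMap ℂ A c :=
  herg a fun s => by rw [ha, zero_dotProduct, phase_zero, one_smul]

/-- In an ergodic system, a spectral element is a multiple of any unitary of the same weight. -/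
theorem exists_eq_smul (herg : α.IsErgodic) (ha : α.IsSpectral w a) (u : unitary A)
    (hu : α.IsSpectral w (u : A)) : ∃ c : ℂ, a = c • (u : A) := by
  obtain ⟨c, hc⟩ := exists_eq_algebraMap herg (by simpa using ha.mul hu.star)
  refine ⟨c, ?_⟩
  calc a = a * Star.star (u : A) * u := by rw [mul_assoc, Unitary.coe_star_mul_self, mul_one]
    _ = c • (u : A) := by rw [hc, Algebra.smul_def]

/-- In an ergodic system, a nonzero spectral element yields a unitary of the same weight. -/
theorem exists_unitary (herg : α.IsErgodic) (ha : α.IsSpectral w a) (h0 : a ≠ 0) :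
    ∃ u : unitary A, α.IsSpectral w (u : A) := by
  have : Nontrivial A := nontrivial_of_ne a 0 h0
  have hn : 0 < ‖a‖ := norm_pos_iff.mpr h0
  obtain ⟨c, hc⟩ := exists_eq_algebraMap herg (by simpa using ha.star.mul ha)
  obtain ⟨d, hd⟩ := exists_eq_algebraMap herg (by simpa using ha.mul ha.star)
  -- Compare `a (a⋆a)` with `(aa⋆) a`.
  have hcd : c = d := by
    have h1 : c • a = d • a := by
      rw [Algebra.smul_def d, ← hd, mul_assoc, hc, ← Algebra.commutes, ← Algebra.smul_def]
    exact smul_left_injective ℂ h0 h1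
  have hnorm : ‖c‖ = ‖a‖ * ‖a‖ := by
    rw [← CStarRing.norm_star_mul_self, hc, norm_algebraMap']
  have hreal : c = (c.re : ℂ) := by
    have h1 : Star.star (Star.star a * a) = Star.star a * a := by rw [star_mul, star_star]
    rw [hc, ← algebraMap_star_comm] at h1
    exact (Complex.conj_eq_iff_re.mp ((algebraMap ℂ A).injective h1)).symm
  -- The real scalar `c` lies in the spectrum of the positive element `a⋆a`. Hence `c = ‖a‖²`, and
  -- `‖a‖⁻¹ • a` is unitary.
  have hpos : 0 ≤ c.re := by
    refine spectrum_star_mul_self_nonneg (b := a) _ ?_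
    rw [hc, hreal, spectrum.mem_iff]
    have : (algebraMap ℝ A) (c.re) - (algebraMap ℂ A) (c.re : ℂ) = 0 := by
      rw [IsScalarTower.algebraMap_apply ℝ ℂ A]; simp
    simp [this]
  have hc' : c = ((‖a‖ * ‖a‖ : ℝ) : ℂ) := by
    rw [← hnorm, hreal, Complex.norm_real, Real.norm_of_nonneg hpos]
  have hn' : (‖a‖ : ℂ) ≠ 0 := by exact_mod_cast hn.ne'
  have key : ((‖a‖ : ℂ)⁻¹ * (‖a‖ : ℂ)⁻¹) * c = 1 := by
    rw [hc']; push_cast; field_simp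
  have hs : Star.star ((‖a‖ : ℂ)⁻¹) = (‖a‖ : ℂ)⁻¹ := by simp
  refine ⟨⟨(‖a‖ : ℂ)⁻¹ • a, ?_, ?_⟩, ha.smul _⟩
  · rw [star_smul, smul_mul_smul_comm, hs, hc, Algebra.smul_def, ← map_mul, key, map_one]
  · rw [star_smul, smul_mul_smul_comm, hs, hd, ← hcd, Algebra.smul_def, ← map_mul, key, map_one]

end IsSpectral

end CStarDynamicalSystem

/-! ## Words in unitaries satisfying the relations of a quantum torus -/

/-- The degree of a word in the free group on `n` letters. -/
def wordDegree {n : ℕ} (w : FreeGroup (Fin n)) : Fin n → ℤ :=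
  (FreeGroup.lift (fun k => Multiplicative.ofAdd (Pi.single k 1 : Fin n → ℤ)) w).toAdd

section wordDegree

variable {n : ℕ}

@[simp] theorem wordDegree_one : wordDegree (1 : FreeGroup (Fin n)) = 0 := by simp [wordDegree]

@[simp] theorem wordDegree_of (k : Fin n) : wordDegree (FreeGroup.of k) = Pi.single k 1 := by
  simp [wordDegree]

@[simp] theorem wordDegree_mul (w w' : FreeGroup (Fin n)) :
    wordDegree (w * w') = wordDegree w + wordDegree w' := by simp [wordDegree]

@[simp] theorem wordDegree_inv (w : FreeGroup (Fin n)) :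
    wordDegree w⁻¹ = -wordDegree w := by simp [wordDegree]

theorem exists_wordDegree_eq (ν : Fin n → ℤ) : ∃ w, wordDegree w = ν := by
  let S : AddSubgroup (Fin n → ℤ) :=
    { carrier := Set.range wordDegree
      zero_mem' := ⟨1, wordDegree_one⟩
      add_mem' := by
        rintro _ _ ⟨w, rfl⟩ ⟨w', rfl⟩
        exact ⟨w * w', wordDegree_mul w w'⟩
      neg_mem' := by
        rintro _ ⟨w, rfl⟩
        exact ⟨w⁻¹, wordDegree_inv w⟩ }
  have h : ∑ k, ν k • (Pi.single k 1 : Fin n → ℤ) ∈ S :=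
    S.sum_mem fun k _ => S.zsmul_mem ⟨FreeGroup.of k, wordDegree_of k⟩ _
  have h2 : ∑ k, ν k • (Pi.single k 1 : Fin n → ℤ) = ν := by
    ext j; simp [Finset.sum_apply, Pi.single_apply]
  rwa [h2] at h

/-- In the abelianization a word is the product of the generators raised to the entries of its
degree. -/
theorem mem_commutator_of_wordDegree_eq_zero {w : FreeGroup (Fin n)} (hw : wordDegree w = 0) :
    w ∈ commutator (FreeGroup (Fin n)) := by
  have h : ∀ w : FreeGroup (Fin n), Abelianization.of w =
      ∏ k, Abelianization.of (FreeGroup.of k) ^ wordDegree w k := by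
    intro w
    induction w using FreeGroup.induction_on with
    | C1 => simp
    | of k =>
      rw [wordDegree_of, Finset.prod_eq_single k] <;> simp +contextual
    | inv_of k hk =>
      rw [map_inv, hk]
      simp
    | mul x y hx hy => simp [hx, hy, zpow_add, Finset.prod_mul_distrib]
  rw [← Abelianization.ker_of, MonoidHom.mem_ker, h, hw]
  simp

end wordDegree

namespace QuantumTorus

variable {n : ℕ} {B : Type*} [CStarAlgebra B]

/-- A unitary that commutes up to phases with the letters commutes up to phases with words. -/
theorem lift_mul_of_forall_mul {v : Fin n → unitary B} {z : unitary B} {t : Fin n → ℝ}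
    (h : ∀ k, (v k : B) * z = (phase (t k) : ℂ) • ((z : B) * v k)) (w : FreeGroup (Fin n)) :
    (FreeGroup.lift v w : B) * z =
      (phase (intVec (wordDegree w) ⬝ᵥ t) : ℂ) • ((z : B) * FreeGroup.lift v w) := by
  induction w using FreeGroup.induction_on with
  | C1 => simp
  | of k => simpa [← coe_phase] using h k
  | inv_of k hk =>
    set x : unitary B := FreeGroup.lift v (FreeGroup.of k)
    set r := intVec (wordDegree (FreeGroup.of k)) ⬝ᵥ t
    rw [map_inv, wordDegree_inv, intVec_neg, neg_dotProduct]
    change (star x : B) * z = _ • ((z : B) * star x)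
    have h1 : (x : B) * star (x : B) = 1 := Unitary.coe_mul_star_self x
    have h2 : star (x : B) * (x : B) = 1 := Unitary.coe_star_mul_self x
    -- Multiplying the relation for `x` by `x⋆` on both sides inverts the phase.
    have h3 : (z : B) * star (x : B) = (phase r : ℂ) • (star (x : B) * z) := by
      calc (z : B) * star (x : B) = star (x : B) * (x * z) * star (x : B) := by
            rw [← mul_assoc, h2, one_mul]
        _ = (phase r : ℂ) • (star (x : B) * z) := by
            rw [hk, mul_smul_comm, smul_mul_assoc, mul_assoc, mul_assoc, h1, mul_one]
    rw [Unitary.coe_star, h3, smul_smul, phase_neg_mul, one_smul]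
  | mul x y hx hy =>
    rw [map_mul, wordDegree_mul, intVec_add, add_dotProduct, phase_add]
    push_cast
    rw [mul_assoc, hy, mul_smul_comm, ← mul_assoc, hx, smul_mul_assoc, smul_smul, mul_assoc,
      mul_comm (phase _ : ℂ)]

/-- Commutation relation for words in unitaries that satisfy the relations of a quantum torus. -/
theorem lift_mul_lift {θ : Matrix (Fin n) (Fin n) ℝ} {v : Fin n → unitary B}
    (h : ∀ k l, (v k : B) * v l = (phase (θ k l) : ℂ) • ((v l : B) * v k))
    (w w' : FreeGroup (Fin n)) : (FreeGroup.lift v w : B) * FreeGroup.lift v w' =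
      (phase (intVec (wordDegree w) ⬝ᵥ θ *ᵥ intVec (wordDegree w')) : ℂ) •
        ((FreeGroup.lift v w' : B) * FreeGroup.lift v w) := by
  refine lift_mul_of_forall_mul (fun k => ?_) w
  -- The one-sided lemma is applied a second time, with the letter `v k` as the fixed unitary.
  -- Reading `h k l` backwards gives the phases `-θ k l`, which cancel below.
  have h1 := lift_mul_of_forall_mul (v := v) (z := v k) (t := fun l => - θ k l) (fun l => by
    rw [h k l, smul_smul, phase_neg_mul, one_smul]) w'
  rw [h1, smul_smul, ← phase_add]
  have : (θ *ᵥ intVec (wordDegree w')) k + intVec (wordDegree w') ⬝ᵥ (fun l => - θ k l) = 0 := by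
    simp only [Matrix.mulVec, dotProduct]
    rw [← Finset.sum_add_distrib]
    exact Finset.sum_eq_zero fun l _ => by ring
  rw [this, phase_zero, one_smul]

theorem lift_isSpectral {α : CStarDynamicalSystem B (Fin n → ℝ)} {v : Fin n → unitary B}
    (h : ∀ k, α.IsSpectral (Pi.single k 1) (v k : B)) (w : FreeGroup (Fin n)) :
    α.IsSpectral (intVec (wordDegree w)) (FreeGroup.lift v w : B) := by
  induction w using FreeGroup.induction_on with
  | C1 => simpa using CStarDynamicalSystem.IsSpectral.one
  | of k => simpa using h k
  | inv_of k hk => rw [map_inv, wordDegree_inv, intVec_neg]; exact hk.star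
  | mul x y hx hy => rw [map_mul, wordDegree_mul, intVec_add]; exact hx.mul hy

/-- Words of degree zero are scalars. -/
theorem exists_lift_eq_algebraMap {θ : Matrix (Fin n) (Fin n) ℝ} {v : Fin n → unitary B}
    (h : ∀ k l, (v k : B) * v l = (phase (θ k l) : ℂ) • ((v l : B) * v k))
    {w : FreeGroup (Fin n)} (hw : wordDegree w = 0) :
    ∃ c : ℂ, (FreeGroup.lift v w : B) = algebraMap ℂ B c := by
  let S : Subgroup (FreeGroup (Fin n)) :=
    { carrier := {w | ∃ c : ℂ, (FreeGroup.lift v w : B) = algebraMap ℂ B c}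
      one_mem' := ⟨1, by simp⟩
      mul_mem' := by
        rintro x y ⟨c, hc⟩ ⟨d, hd⟩
        exact ⟨c * d, by rw [map_mul, map_mul, ← hc, ← hd]; rfl⟩
      inv_mem' := by
        rintro x ⟨c, hc⟩
        refine ⟨star c, ?_⟩
        rw [map_inv, algebraMap_star_comm, ← hc]; rfl }
  suffices hS : commutator (FreeGroup (Fin n)) ≤ S from
    hS (mem_commutator_of_wordDegree_eq_zero hw)
  -- A degree-zero word lies in the commutator subgroup, and a commutator of two words is the phase
  -- by which they fail to commute.
  refine Subgroup.commutator_le.mpr fun x _ y _ =>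
    ⟨phase (intVec (wordDegree x) ⬝ᵥ θ *ᵥ intVec (wordDegree y)), ?_⟩
  rw [commutatorElement_def]
  have h1 : (FreeGroup.lift v (x * y * x⁻¹ * y⁻¹) : B) =
      (FreeGroup.lift v x : B) * FreeGroup.lift v y * star (FreeGroup.lift v x : B) *
        star (FreeGroup.lift v y : B) := by
    simp only [map_mul, map_inv]; rfl
  rw [h1, lift_mul_lift h, smul_mul_assoc, smul_mul_assoc, mul_assoc (FreeGroup.lift v y : B),
    Unitary.mul_star_self_of_mem (FreeGroup.lift v x).2, mul_one,
    Unitary.mul_star_self_of_mem (FreeGroup.lift v y).2, Algebra.algebraMap_eq_smul_one]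

end QuantumTorus

/-! ## Fourier analysis on the torus -/

namespace UnitAddTorus

open MeasureTheory

variable {n : ℕ}

/-- The normalized Haar measure of the torus. -/
abbrev haar (n : ℕ) : Measure (UnitAddTorus (Fin n)) :=
  Measure.pi fun _ => AddCircle.haarAddCircle

theorem mFourierCoeff_eq {E : Type*} [NormedAddCommGroup E] [NormedSpace ℂ E]
    (f : UnitAddTorus (Fin n) → E) (ν : Fin n → ℤ) :
    mFourierCoeff f ν = ∫ t, mFourier (-ν) t • f t ∂haar n := rfl

/-- A continuous function without Fourier coefficients vanishes. -/
theorem eq_zero_of_mFourierCoeff_eq_zero (f : C(UnitAddTorus (Fin n), ℂ))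
    (h : ∀ ν, mFourierCoeff f ν = 0) : f = 0 := by
  -- Summable coefficients make the Fourier series converge pointwise to `f`; here all its terms are
  -- zero.
  have hs : Summable (mFourierCoeff f) := by
    rw [show mFourierCoeff f = fun _ => 0 from funext h]; exact summable_zero
  ext x
  have hx := hasSum_mFourier_series_apply_of_summable hs x
  refine hx.unique ?_
  rw [show (fun i => mFourierCoeff f i • mFourier i x) = fun _ => 0 from
    funext fun i => by rw [h, zero_smul]]
  exact hasSum_zero

/-- The projection `ℝ^n → (ℝ/ℤ)^n`. -/
def ofReal (n : ℕ) : C(Fin n → ℝ, UnitAddTorus (Fin n)) where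
  toFun s i := (s i : UnitAddCircle)
  continuous_toFun := continuous_pi fun i =>
    (AddCircle.continuous_mk' (1 : ℝ)).comp (continuous_apply i)

/-- A product of open quotient maps is again one. This lets continuous periodic functions descend to
the torus. -/
theorem isQuotientMap_ofReal : Topology.IsQuotientMap (ofReal n) :=
  (IsOpenQuotientMap.piMap (fun _ : Fin n =>
    QuotientAddGroup.isOpenQuotientMap_mk (N := AddSubgroup.zmultiples (1 : ℝ)))).isQuotientMap

theorem exists_intVec_of_ofReal_eq {s t : Fin n → ℝ} (h : ofReal n s = ofReal n t) :
    ∃ m : Fin n → ℤ, s = t + intVec m := by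
  have : ∀ i, ∃ m : ℤ, s i = t i + m := fun i => by
    have h1 : ((s i - t i : ℝ) : UnitAddCircle) = 0 := by
      rw [AddCircle.coe_sub, sub_eq_zero]; exact congrFun h i
    obtain ⟨m, hm⟩ := (AddCircle.coe_eq_zero_iff (1 : ℝ)).mp h1
    exact ⟨m, by rw [zsmul_one] at hm; rw [hm]; ring⟩
  choose m hm using this
  exact ⟨m, funext hm⟩

theorem mFourier_ofReal (ν : Fin n → ℤ) (s : Fin n → ℝ) :
    mFourier ν (ofReal n s) = QuantumTorus.phase (intVec ν ⬝ᵥ s) := by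
  change ∏ i, fourier (ν i) ((s i : ℝ) : UnitAddCircle) = _
  simp only [fourier_coe_apply, QuantumTorus.coe_phase, ← Complex.exp_sum]
  congr 1
  simp only [dotProduct, intVec_apply, Complex.ofReal_sum, Finset.mul_sum]
  refine Finset.sum_congr rfl fun i _ => ?_
  push_cast
  ring

end UnitAddTorus

/-! ### Spectral decomposition of a periodic action. -/

namespace CStarDynamicalSystem

open MeasureTheory UnitAddTorus QuantumTorus

variable {n : ℕ} {A : Type*} [CStarAlgebra A]

/-- The action of `ℝ^n` factors through the torus `ℝ^n/ℤ^n`. -/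
def IsPeriodic (α : CStarDynamicalSystem A (Fin n → ℝ)) : Prop :=
  ∀ m : Fin n → ℤ, intVec m ∈ α.ker

theorem norm_act (α : CStarDynamicalSystem A (Fin n → ℝ)) (s : Fin n → ℝ) (x : A) :
    ‖α.act s x‖ = ‖x‖ :=
  NonUnitalStarAlgHom.norm_map (α.act s) (α.act s).injective x

/-- The automorphism `α_s`, as a continuous linear map. -/
def actL (α : CStarDynamicalSystem A (Fin n → ℝ)) (s : Fin n → ℝ) : A →L[ℂ] A :=
  LinearMap.mkContinuous
    { toFun := α.act s
      map_add' := map_add _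
      map_smul' := fun c x => map_smul (α.act s) c x } 1
    fun x => by simpa using (α.norm_act s x).le

@[simp] theorem actL_apply (α : CStarDynamicalSystem A (Fin n → ℝ)) (s : Fin n → ℝ) (x : A) :
    α.actL s x = α.act s x := rfl

/-- The orbit map `s ↦ α_s(x)` of a periodic action, as a function on the torus. -/
def torusOrbit {α : CStarDynamicalSystem A (Fin n → ℝ)} (hα : α.IsPeriodic) (x : A) :
    C(UnitAddTorus (Fin n), A) :=
  isQuotientMap_ofReal.lift
    ⟨fun s => α.act s x, α.continuous_act.comp (by fun_prop : Continuous fun s => (s, x))⟩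
    fun s t hst => by
      obtain ⟨m, rfl⟩ := exists_intVec_of_ofReal_eq hst
      exact (α.act_add t (intVec m) x).trans (congrArg _ (hα m x))

variable {α : CStarDynamicalSystem A (Fin n → ℝ)} (hα : α.IsPeriodic)

@[simp] theorem torusOrbit_ofReal (s : Fin n → ℝ) (x : A) :
    torusOrbit hα x (ofReal n s) = α.act s x :=
  DFunLike.congr_fun (isQuotientMap_ofReal.lift_comp _ _ :
    (torusOrbit hα x).comp (ofReal n) = ⟨fun s => α.act s x, _⟩) s

theorem integrable_torusOrbit (ν : Fin n → ℤ) (x : A) :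
    Integrable (fun t => mFourier ν t • torusOrbit hα x t) (haar n) :=
  Continuous.integrable_of_hasCompactSupport (by fun_prop) (HasCompactSupport.of_compactSpace _)

/-- The component of weight `ν` of `x`. -/
def spectralComponent (ν : Fin n → ℤ) (x : A) : A := mFourierCoeff (torusOrbit hα x) ν

theorem spectralComponent_eq (ν : Fin n → ℤ) (x : A) : spectralComponent hα ν x =
    ∫ t, mFourier (-ν) t • torusOrbit hα x t ∂haar n := rfl

theorem norm_torusOrbit (x : A) (t : UnitAddTorus (Fin n)) : ‖torusOrbit hα x t‖ = ‖x‖ := by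
  obtain ⟨s, rfl⟩ := isQuotientMap_ofReal.surjective t
  rw [torusOrbit_ofReal, norm_act]

/-- The projection to the component of weight `ν`, as a continuous linear map. -/
def spectralProjection (ν : Fin n → ℤ) : A →L[ℂ] A :=
  LinearMap.mkContinuous
    { toFun := spectralComponent hα ν
      map_add' := fun x y => by
        simp only [spectralComponent_eq]
        rw [← integral_add (integrable_torusOrbit hα _ x) (integrable_torusOrbit hα _ y)]
        congr 1
        ext t
        obtain ⟨s, rfl⟩ := isQuotientMap_ofReal.surjective t
        simp only [torusOrbit_ofReal, map_add, smul_add]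
      map_smul' := fun c x => by
        simp only [spectralComponent_eq, RingHom.id_apply]
        rw [← integral_smul]
        congr 1
        ext t
        obtain ⟨s, rfl⟩ := isQuotientMap_ofReal.surjective t
        rw [torusOrbit_ofReal, torusOrbit_ofReal, map_smul, smul_comm] } 1
    fun x => by
      refine (norm_integral_le_of_norm_le_const (μ := haar n) (C := ‖x‖) (Filter.Eventually.of_forall
        fun t => ?_)).trans_eq (by simp)
      rw [norm_smul, norm_torusOrbit]
      refine mul_le_of_le_one_left (norm_nonneg x) ?_
      exact ((mFourier (-ν)).norm_coe_le_norm t).trans_eq mFourier_norm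

@[simp] theorem spectralProjection_apply (ν : Fin n → ℤ) (x : A) :
    spectralProjection hα ν x = spectralComponent hα ν x := rfl

/-- Equivariant continuous linear maps respect spectral components. -/
theorem map_spectralComponent {B : Type*} [CStarAlgebra B]
    {α' : CStarDynamicalSystem B (Fin n → ℝ)} (hα' : α'.IsPeriodic) (f : A →L[ℂ] B)
    (hf : ∀ s x, f (α.act s x) = α'.act s (f x)) (ν : Fin n → ℤ) (x : A) :
    f (spectralComponent hα ν x) = spectralComponent hα' ν (f x) := by
  rw [spectralComponent_eq, spectralComponent_eq,
    ← f.integral_comp_comm (integrable_torusOrbit hα _ x)]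
  congr 1
  ext t
  obtain ⟨s, rfl⟩ := isQuotientMap_ofReal.surjective t
  rw [map_smul, torusOrbit_ofReal, torusOrbit_ofReal, hf]

/-- Since `ℝ^n` is commutative, `α_s` is itself equivariant. -/
theorem act_spectralComponent (s : Fin n → ℝ) (ν : Fin n → ℤ) (x : A) :
    α.act s (spectralComponent hα ν x) = spectralComponent hα ν (α.act s x) :=
  map_spectralComponent hα hα (α.actL s)
    (fun t x => by simp only [actL_apply, ← α.act_add, add_comm]) ν x

/-- Replacing `x` by `α_s x` translates the integrand by `s`, up to the phase of the character;
translation invariance of Haar measure removes the translation. -/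
theorem isSpectral_spectralComponent (ν : Fin n → ℤ) (x : A) :
    α.IsSpectral (intVec ν) (spectralComponent hα ν x) := fun s => by
  have h : ∀ t, mFourier (-ν) t • torusOrbit hα (α.act s x) t = (phase (intVec ν ⬝ᵥ s) : ℂ) •
      (mFourier (-ν) (t + ofReal n s) • torusOrbit hα x (t + ofReal n s)) := fun t => by
    obtain ⟨r, rfl⟩ := isQuotientMap_ofReal.surjective t
    have h1 : ofReal n r + ofReal n s = ofReal n (r + s) := rfl
    rw [h1, torusOrbit_ofReal, torusOrbit_ofReal, α.act_add, smul_smul, mFourier_ofReal,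
      mFourier_ofReal, ← phase_add, dotProduct_add, intVec_neg, neg_dotProduct, neg_dotProduct]
    congr 3
    ring
  rw [act_spectralComponent, spectralComponent_eq, spectralComponent_eq]
  simp only [h]
  rw [integral_smul, integral_add_right_eq_self
    (fun t => mFourier (-ν) t • torusOrbit hα x t) (ofReal n s)]

/-- The two phases cancel, leaving a constant integrand over a probability measure. -/
theorem spectralComponent_of_isSpectral {ν : Fin n → ℤ} {a : A} (ha : α.IsSpectral (intVec ν) a) :
    spectralComponent hα ν a = a := by
  have h : ∀ t, mFourier (-ν) t • torusOrbit hα a t = a := fun t => by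
    obtain ⟨s, rfl⟩ := isQuotientMap_ofReal.surjective t
    rw [torusOrbit_ofReal, ha, mFourier_ofReal, smul_smul, intVec_neg, neg_dotProduct,
      phase_neg_mul, one_smul]
  rw [spectralComponent_eq]
  simp [h]

/-- A spectral element has no components of other weights. -/
theorem spectralComponent_of_isSpectral_of_ne {μ ν : Fin n → ℤ} (hμν : μ ≠ ν) {a : A}
    (ha : α.IsSpectral (intVec μ) a) : spectralComponent hα ν a = 0 := by
  obtain ⟨k, hk⟩ := Function.ne_iff.mp hμν
  have hk' : ((μ k : ℝ) - ν k) ≠ 0 := sub_ne_zero.mpr (by exact_mod_cast hk)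
  -- Chosen so that `⟨μ - ν, s⟩ = 1/2`: the two weights then act by opposite phases on the same
  -- component, which must vanish.
  let s : Fin n → ℝ := Pi.single k ((1 / 2) / ((μ k : ℝ) - ν k))
  have h1 : spectralComponent hα ν (α.act s a) =
      (phase (intVec μ ⬝ᵥ s) : ℂ) • spectralComponent hα ν a := by
    rw [ha, ← spectralProjection_apply, map_smul, spectralProjection_apply]
  rw [← act_spectralComponent, isSpectral_spectralComponent hα ν a s] at h1
  have h2 : (phase (intVec μ ⬝ᵥ s) : ℂ) = - phase (intVec ν ⬝ᵥ s) := by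
    have : intVec μ ⬝ᵥ s = 1 / 2 + intVec ν ⬝ᵥ s := by
      simp only [s, dotProduct_single, intVec_apply]
      field_simp
      ring
    rw [this, phase_add, phase_half, neg_one_mul]
  rw [h2, neg_smul, eq_neg_iff_add_eq_zero, ← add_smul, smul_eq_zero] at h1
  refine h1.resolve_left ?_
  rw [← two_mul]
  simp

/-- A continuous linear functional that vanishes on the spectral components of `x` vanishes at
`x`. -/
theorem functional_eq_zero (f : A →L[ℂ] ℂ) {x : A}
    (h : ∀ ν, f (spectralComponent hα ν x) = 0) : f x = 0 := by
  -- The Fourier coefficients of the scalar function `f ∘ torusOrbit` are the values of `f` on the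
  -- spectral components; evaluation at the origin then gives `f x`.
  have h1 : (f : C(A, ℂ)).comp (torusOrbit hα x) = 0 :=
    eq_zero_of_mFourierCoeff_eq_zero _ fun ν => by
      rw [← h ν, spectralComponent_eq, ← f.integral_comp_comm (integrable_torusOrbit hα _ x),
        mFourierCoeff_eq]
      congr 1
      ext t
      rw [map_smul]
      rfl
  have h2 := DFunLike.congr_fun h1 (ofReal n 0)
  simpa [α.act_zero] using h2

theorem eq_zero_of_spectralComponent_eq_zero {x : A} (h : ∀ ν, spectralComponent hα ν x = 0) :
    x = 0 :=
  SeparatingDual.eq_zero_of_forall_dual_eq_zero (R := ℂ) fun f =>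
    functional_eq_zero hα f fun ν => by rw [h, map_zero]

/-- A closed subspace that contains the spectral components of `x` contains `x`. -/
theorem mem_of_spectralComponent_mem (S : Submodule ℂ A) (hS : IsClosed (S : Set A)) {x : A}
    (h : ∀ ν, spectralComponent hα ν x ∈ S) : x ∈ S := by
  by_contra hx
  have : IsClosed (S : Set A) := hS
  have hq : S.mkQ x ≠ 0 := by simpa using hx
  -- Hahn–Banach in the quotient by the closed subspace gives a functional that kills `S` but not
  -- `x`.
  obtain ⟨g, hg⟩ := SeparatingDual.exists_ne_zero (R := ℂ) hq
  refine hg (functional_eq_zero hα (g.comp S.mkQL) fun ν => ?_)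
  change g (S.mkQ _) = 0
  rw [Submodule.mkQ_apply, (Submodule.Quotient.mk_eq_zero S).mpr (h ν), map_zero]

end CStarDynamicalSystem

namespace QuantumTorus

open CStarDynamicalSystem

variable {n : ℕ} {θ : Matrix (Fin n) (Fin n) ℝ}

/-! ## The gauge action is periodic and ergodic -/

theorem incl_word (w : FreeGroup (Fin n)) :
    incl θ (PreTorus.word θ w) = (FreeGroup.lift (genU θ) w : QuantumTorus θ) := by
  induction w using FreeGroup.induction_on with
  | C1 => simp
  | of k => simp [genU, gen, PreTorus.gen]
  | inv_of k hk =>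
    rw [← PreTorus.star_word, ← star_incl, hk, map_inv]
    rfl
  | mul x y hx hy => simp only [map_mul, hx, hy]; rfl

theorem isSpectral_genU (k : Fin n) :
    (gauge θ).IsSpectral (Pi.single k 1) (genU θ k : QuantumTorus θ) := fun s => by
  rw [single_one_dotProduct]
  exact gaugeHom_gen s k

theorem gauge_isPeriodic : (gauge θ).IsPeriodic := fun m x => by
  have h : gaugeHom θ (intVec m) = StarAlgHom.id ℂ (QuantumTorus θ) := hom_ext fun k => by
    rw [gaugeHom_gen, ← coe_phase, intVec_apply, phase_eq_one_iff.mpr ⟨m k, rfl⟩, one_smul]; rfl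
  exact DFunLike.congr_fun h x

theorem genU_mul_genU (k l : Fin n) : (genU θ k : QuantumTorus θ) * genU θ l =
    (phase (θ k l) : ℂ) • ((genU θ l : QuantumTorus θ) * genU θ k) := gen_mul_gen k l

/-- The projection to weight zero fixes invariant elements. It sends each word to a scalar, hence by
density and continuity everything to the closed line `ℂ · 1`. -/
theorem gauge_isErgodic : (gauge θ).IsErgodic := fun x hx => by
  let S : Submodule ℂ (QuantumTorus θ) := Submodule.span ℂ {1}
  have hS : IsClosed (S : Set (QuantumTorus θ)) := S.closed_of_finiteDimensional
  have key : ∀ x, spectralProjection (gauge_isPeriodic (θ := θ)) 0 x ∈ S := fun x => by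
    refine denseRange_incl.induction_on
      (p := fun x => spectralProjection (gauge_isPeriodic (θ := θ)) 0 x ∈ S) x
      (hS.preimage (spectralProjection (gauge_isPeriodic (θ := θ)) 0).continuous) fun a => ?_
    induction a using PreTorus.induction with
    | word w =>
      have hw := lift_isSpectral (isSpectral_genU (θ := θ)) w
      rw [incl_word, spectralProjection_apply]
      by_cases h : wordDegree w = 0
      · obtain ⟨c, hc⟩ := exists_lift_eq_algebraMap (genU_mul_genU (θ := θ)) h
        rw [h] at hw
        rw [spectralComponent_of_isSpectral _ hw, hc, Algebra.algebraMap_eq_smul_one]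
        exact S.smul_mem c (Submodule.mem_span_singleton_self 1)
      · rw [spectralComponent_of_isSpectral_of_ne _ h hw]
        exact S.zero_mem
    | add x y hx hy => rw [map_add, map_add]; exact S.add_mem hx hy
    | smul c x hx => rw [map_smul, map_smul]; exact S.smul_mem c hx
  have h := key x
  have hx' : (gauge θ).IsSpectral (intVec 0) x := fun s => by
    rw [hx, intVec_zero, zero_dotProduct, phase_zero, one_smul]
  rw [spectralProjection_apply, spectralComponent_of_isSpectral _ hx'] at h
  obtain ⟨c, hc⟩ := Submodule.mem_span_singleton.mp h
  exact ⟨c, by rw [Algebra.algebraMap_eq_smul_one, hc]⟩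

/-- With no generators there are no relations to check, so the algebra maps unitally to `ℂ`. This
covers `n = 0`, where the kernel cannot detect that the algebra is nonzero. -/
theorem nontrivial_of_isEmpty [IsEmpty (Fin n)] : Nontrivial (QuantumTorus θ) :=
  (lift (θ := θ) (fun _ => (1 : unitary ℂ)) fun k => isEmptyElim k).toRingHom.domain_nontrivial

/-! ## Ergodic periodic actions with full spectrum -/

section classification

variable {A : Type*} [CStarAlgebra A] {α : CStarDynamicalSystem A (Fin n → ℝ)}
  {v : Fin n → unitary A}

/-- The ⋆-homomorphism `u_k ↦ v_k`, with the relations expressed by phases. -/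
def liftPhase (v : Fin n → unitary A)
    (h : ∀ k l, (v k : A) * v l = (phase (θ k l) : ℂ) • ((v l : A) * v k)) :
    QuantumTorus θ →⋆ₐ[ℂ] A :=
  lift v h

theorem liftPhase_gen
    (h : ∀ k l, (v k : A) * v l = (phase (θ k l) : ℂ) • ((v l : A) * v k)) (k : Fin n) :
    liftPhase v h (gen θ k) = v k :=
  lift_gen v h k

theorem liftPhase_lift_genU
    (h : ∀ k l, (v k : A) * v l = (phase (θ k l) : ℂ) • ((v l : A) * v k))
    (w : FreeGroup (Fin n)) :
    liftPhase v h (FreeGroup.lift (genU θ) w : QuantumTorus θ) = (FreeGroup.lift v w : A) := by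
  rw [← incl_word]
  exact (lift_incl v h _).trans (preLift_word v w)

/-- Both sides are ⋆-homomorphisms in `x`, so it suffices to compare them on the generators. -/
theorem liftPhase_gauge
    (h : ∀ k l, (v k : A) * v l = (phase (θ k l) : ℂ) • ((v l : A) * v k))
    (hv : ∀ k, α.IsSpectral (Pi.single k 1) (v k : A)) (s : Fin n → ℝ) (x : QuantumTorus θ) :
    liftPhase v h ((gauge θ).act s x) = α.act s (liftPhase v h x) := by
  have : (liftPhase v h).comp (gaugeHom θ s) = (α.act s : A →⋆ₐ[ℂ] A).comp (liftPhase v h) :=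
    hom_ext fun k => by
      have := hv k s
      rw [single_one_dotProduct] at this
      rw [StarAlgHom.comp_apply, gaugeHom_gen, map_smul, liftPhase_gen]
      refine Eq.trans ?_ (congrArg (α.act s) (liftPhase_gen h k)).symm
      exact this.symm
  exact DFunLike.congr_fun this x

/-- Unitaries of weights `e_k` in an ergodic periodic system generate a copy of a quantum torus. -/
theorem liftPhase_bijective [Nontrivial A] (hα : α.IsPeriodic) (herg : α.IsErgodic)
    (h : ∀ k l, (v k : A) * v l = (phase (θ k l) : ℂ) • ((v l : A) * v k))
    (hv : ∀ k, α.IsSpectral (Pi.single k 1) (v k : A)) :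
    Function.Bijective (liftPhase (θ := θ) v h) := by
  let f : QuantumTorus θ →L[ℂ] A := ⟨(liftPhase v h).toAlgHom.toLinearMap, continuous_hom _⟩
  have hf : ∀ x, f x = liftPhase v h x := fun _ => rfl
  have hinj : Function.Injective (liftPhase (θ := θ) v h) := by
    refine (injective_iff_map_eq_zero _).mpr fun x hx => ?_
    -- Each component of `x` is a multiple of a word in the generators, and the image of that word
    -- is a unitary, hence nonzero.
    refine eq_zero_of_spectralComponent_eq_zero gauge_isPeriodic fun ν => ?_
    obtain ⟨w, rfl⟩ := exists_wordDegree_eq ν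
    obtain ⟨c, hc⟩ := (isSpectral_spectralComponent gauge_isPeriodic (wordDegree w)
      x).exists_eq_smul gauge_isErgodic _ (lift_isSpectral (isSpectral_genU (θ := θ)) w)
    have h1 := map_spectralComponent gauge_isPeriodic hα f (liftPhase_gauge h hv) (wordDegree w) x
    rw [hc, map_smul, hf, hf, hx, liftPhase_lift_genU, ← spectralProjection_apply, map_zero] at h1
    have h2 : (FreeGroup.lift v w : A) ≠ 0 := fun h0 => one_ne_zero (α := A) <| by
      rw [← Unitary.mul_star_self_of_mem (FreeGroup.lift v w).2, h0, zero_mul]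
    rw [hc, (smul_eq_zero.mp h1).resolve_right h2, zero_smul]
  refine ⟨hinj, fun x => ?_⟩
  -- An injective ⋆-homomorphism of C⋆-algebras is isometric, so its range is closed; it remains to
  -- reach every spectral component.
  have hclosed : IsClosed (LinearMap.range f.toLinearMap : Set A) :=
    (NonUnitalStarAlgHom.isometry (liftPhase (θ := θ) v h) hinj).isClosedEmbedding.isClosed_range
  refine mem_of_spectralComponent_mem hα _ hclosed (x := x) fun ν => ?_
  obtain ⟨w, rfl⟩ := exists_wordDegree_eq ν
  obtain ⟨c, hc⟩ := (isSpectral_spectralComponent hα (wordDegree w) x).exists_eq_smul herg _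
    (lift_isSpectral hv w)
  refine ⟨c • (FreeGroup.lift (genU θ) w : QuantumTorus θ), ?_⟩
  rw [hc, map_smul]
  exact congrArg _ (liftPhase_lift_genU h w)

/-- Spectral unitaries in an ergodic system satisfy the relations of some quantum torus. -/
theorem exists_skew_relations [Nontrivial A] (herg : α.IsErgodic) {W : Fin n → Fin n → ℝ}
    (hv : ∀ k, α.IsSpectral (W k) (v k : A)) : ∃ θ' : Matrix (Fin n) (Fin n) ℝ, θ'ᵀ = -θ' ∧
      ∀ k l, (v k : A) * v l = (phase (θ' k l) : ℂ) • ((v l : A) * v k) := by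
  have h1 : ∀ k l, ∃ t : ℝ, (v k : A) * v l = (phase t : ℂ) • ((v l : A) * v k) := fun k l => by
    obtain ⟨c, hc⟩ := ((hv k).mul (hv l)).exists_eq_smul herg (v l * v k)
      (by rw [add_comm]; exact (hv l).mul (hv k))
    have hn : ‖c‖ = 1 := by
      have := congrArg norm hc
      rw [norm_smul, CStarRing.norm_coe_unitary, mul_one] at this
      rw [← this]
      exact CStarRing.norm_coe_unitary (v k * v l)
    obtain ⟨t, rfl⟩ := exists_phase_eq hn
    exact ⟨t, hc⟩
  choose t ht using h1
  -- The phases determine `t` only modulo `ℤ`, so skew-symmetry is imposed by keeping the entries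
  -- above the diagonal and reflecting them.
  refine ⟨Matrix.of fun k l => if k < l then t k l else if l < k then - t l k else 0, ?_, ?_⟩
  · ext k l
    rcases lt_trichotomy k l with h | rfl | h
    · simp [h, h.not_gt]
    · simp
    · simp [h, h.not_gt]
  · intro k l
    rcases lt_trichotomy k l with h | rfl | h
    · simp only [Matrix.of_apply, if_pos h]; exact ht k l
    · simp only [Matrix.of_apply, lt_irrefl, if_false]; rw [phase_zero, one_smul]
    · simp only [Matrix.of_apply, if_pos h, if_neg h.not_gt]
      rw [ht l k, smul_smul, phase_neg_mul, one_smul]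

end classification

end QuantumTorus

/-! ### Weights of an action with kernel `ℤ^n`, and change of coordinates. -/

namespace CStarDynamicalSystem

variable {n : ℕ} {A : Type*} [CStarAlgebra A] {α : CStarDynamicalSystem A (Fin n → ℝ)}

/-- If the kernel of an ergodic action of `ℝ^n` is exactly `ℤ^n`, then all weights occur. -/
theorem exists_unitary_isSpectral [Nontrivial A] (hα : α.IsPeriodic) (herg : α.IsErgodic)
    (hker : ∀ s ∈ α.ker, ∃ m : Fin n → ℤ, s = intVec m) (k : Fin n) :
    ∃ u : unitary A, α.IsSpectral (Pi.single k 1) (u : A) := by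
  let H : AddSubgroup (Fin n → ℤ) :=
    { carrier := {ν | ∃ u : unitary A, α.IsSpectral (intVec ν) (u : A)}
      zero_mem' := ⟨1, by simpa using IsSpectral.one⟩
      add_mem' := by
        rintro μ ν ⟨u, hu⟩ ⟨u', hu'⟩
        exact ⟨u * u', by rw [intVec_add]; exact hu.mul hu'⟩
      neg_mem' := by
        rintro μ ⟨u, hu⟩
        exact ⟨star u, by rw [intVec_neg]; exact hu.star⟩ }
  suffices hk : Pi.single k 1 ∈ H by simpa [H] using hk
  by_contra hk
  have hk' : (QuotientAddGroup.mk' H) (Pi.single k 1) ≠ 0 := by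
    simpa [QuotientAddGroup.eq_zero_iff] using hk
  -- A `ℚ/ℤ`-valued character of `ℤ^n / H` that is nontrivial on `e_k`. Rational lifts `q j` of its
  -- values on the basis give the point `s` of `ℝ^n`.
  obtain ⟨c, hc⟩ := CharacterModule.exists_character_apply_ne_zero_of_ne_zero hk'
  let c' : (Fin n → ℤ) →+ AddCircle (1 : ℚ) := AddMonoidHom.comp c (QuotientAddGroup.mk' H)
  have hcoe : ∀ j, ∃ q : ℚ, (q : AddCircle (1 : ℚ)) = c' (Pi.single j 1) := fun j =>
    QuotientAddGroup.mk_surjective _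
  choose q hq using hcoe
  have hsum : ∀ ν : Fin n → ℤ, c' ν = ((∑ j, ν j * q j : ℚ) : AddCircle (1 : ℚ)) := fun ν => by
    have h2 : ν = ∑ j, ν j • (Pi.single j 1 : Fin n → ℤ) := by
      ext i; simp [Finset.sum_apply, Pi.single_apply]
    conv_lhs => rw [h2]
    rw [map_sum]
    refine Eq.trans ?_ (map_sum (QuotientAddGroup.mk' (AddSubgroup.zmultiples (1 : ℚ))) _ _).symm
    refine Finset.sum_congr rfl fun j _ => ?_
    rw [map_zsmul, ← hq, ← AddCircle.coe_zsmul, zsmul_eq_mul]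
    rfl
  let s : Fin n → ℝ := fun j => (q j : ℝ)
  -- For a weight `ν` that occurs, `ν ∈ H`, so the character vanishes at `ν` and `⟨ν, s⟩` is an
  -- integer. Thus `α_s` fixes every spectral component.
  have hs : s ∈ α.ker := fun x => by
    refine sub_eq_zero.mp (eq_zero_of_spectralComponent_eq_zero hα fun ν => ?_)
    rw [← spectralProjection_apply, map_sub, spectralProjection_apply, spectralProjection_apply,
      ← act_spectralComponent, isSpectral_spectralComponent]
    by_cases h0 : spectralComponent hα ν x = 0
    · rw [h0, smul_zero, sub_zero]
    · have hν : ν ∈ H := (isSpectral_spectralComponent hα ν x).exists_unitary herg h0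
      have h3 : c' ν = 0 := by
        change c (QuotientAddGroup.mk' H ν) = 0
        rw [(QuotientAddGroup.eq_zero_iff ν).mpr hν |> (show QuotientAddGroup.mk' H ν = 0 from ·)]
        exact map_zero c
      rw [hsum, AddCircle.coe_eq_zero_iff] at h3
      obtain ⟨m, hm⟩ := h3
      rw [phase_eq_one_iff.mpr ⟨m, ?_⟩, one_smul, sub_self]
      rw [zsmul_one] at hm
      have := congrArg (Rat.cast : ℚ → ℝ) hm
      push_cast at this
      simpa [s, dotProduct] using this.symm
  -- Now `q k` is an integer, so the character is trivial on `e_k`, a contradiction.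
  obtain ⟨m, hm⟩ := hker s hs
  have hqk : q k = m k := by
    have : (q k : ℝ) = m k := congrFun hm k
    exact_mod_cast this
  refine hc ((hq k).symm.trans ?_)
  rw [AddCircle.coe_eq_zero_iff]
  exact ⟨m k, by rw [hqk, zsmul_one]⟩

/-- The pullback of an action of `ℝ^n` along a real matrix. -/
def pullback (β : CStarDynamicalSystem A (Fin n → ℝ)) (R : Matrix (Fin n) (Fin n) ℝ) :
    CStarDynamicalSystem A (Fin n → ℝ) where
  act s := β.act (R *ᵥ s)
  act_zero a := by rw [Matrix.mulVec_zero, β.act_zero]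
  act_add s t a := by rw [Matrix.mulVec_add, β.act_add]
  continuous_act := β.continuous_act.comp
    (((Continuous.matrix_mulVec continuous_const continuous_fst)).prodMk continuous_snd)

theorem pullback_act (β : CStarDynamicalSystem A (Fin n → ℝ)) (R : Matrix (Fin n) (Fin n) ℝ)
    (s : Fin n → ℝ) (a : A) : (β.pullback R).act s a = β.act (R *ᵥ s) a := rfl

end CStarDynamicalSystem

/-- Multiplication by an invertible real matrix, as an isomorphism of topological groups. -/
def Matrix.mulVecContinuousAddEquiv {n : ℕ} (P R : Matrix (Fin n) (Fin n) ℝ) (hPR : P * R = 1)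
    (hRP : R * P = 1) : (Fin n → ℝ) ≃ₜ+ (Fin n → ℝ) where
  toFun s := P *ᵥ s
  invFun s := R *ᵥ s
  left_inv s := by simp [hRP]
  right_inv s := by simp [hPR]
  map_add' s t := Matrix.mulVec_add P s t
  continuous_toFun := Continuous.matrix_mulVec continuous_const continuous_id
  continuous_invFun := Continuous.matrix_mulVec continuous_const continuous_id

end

/-! ### The classification of ergodic lifts. -/

open QuantumTorus

theorem lemma4p3 {n : ℕ} (θ : Matrix (Fin n) (Fin n) ℝ) (hskew : θᵀ = -θ)
    (hθ : QuiteIrrational θ)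
    {A : Type*} [CStarAlgebra A] (ι : QuantumTorus θ →⋆ₐ[ℂ] A)
    (β : CStarDynamicalSystem A (Fin n → ℝ))
    (hβ : QuantumTorus.IsGaugeLift ι β) (herg : β.IsErgodic)
    (M : Matrix (Fin n) (Fin n) ℤ) (hM : M.det ≠ 0)
    (hker : (β.ker : Set (Fin n → ℝ)) =
      Set.range fun m : Fin n → ℤ => (M.map (Int.cast : ℤ → ℝ)) *ᵥ fun i => (m i : ℝ)) :
    ∃ θ' : Matrix (Fin n) (Fin n) ℝ, θ'ᵀ = -θ' ∧
      (∃ N : Matrix (Fin n) (Fin n) ℤ,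
        M.map (Int.cast : ℤ → ℝ) * θ' * (M.map (Int.cast : ℤ → ℝ))ᵀ =
          θ + N.map (Int.cast : ℤ → ℝ)) ∧
      β.Equivalent (QuantumTorus.gauge θ') := by
  set R : Matrix (Fin n) (Fin n) ℝ := M.map (Int.cast : ℤ → ℝ) with hR
  have hdet : IsUnit R.det := by
    have : R.det = (M.det : ℝ) := (Int.cast_det M).symm
    rw [this]
    exact IsUnit.mk0 _ (by exact_mod_cast hM)
  have hRinv : R⁻¹ * R = 1 := Matrix.nonsing_inv_mul R hdet
  have hinvR : R * R⁻¹ = 1 := Matrix.mul_nonsing_inv R hdet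
  let α := β.pullback R
  have hα : α.IsPeriodic := fun m => by
    have : R *ᵥ intVec m ∈ (β.ker : Set (Fin n → ℝ)) := by rw [hker]; exact ⟨m, rfl⟩
    exact this
  have hkerα : ∀ s ∈ α.ker, ∃ m : Fin n → ℤ, s = intVec m := fun s hs => by
    have h1 : R *ᵥ s ∈ (β.ker : Set (Fin n → ℝ)) := hs
    rw [hker] at h1
    obtain ⟨m, hm⟩ := h1
    refine ⟨m, ?_⟩
    have := congrArg (R⁻¹ *ᵥ ·) hm
    simp only [Matrix.mulVec_mulVec, hRinv, Matrix.one_mulVec] at this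
    exact this.symm
  have hergα : α.IsErgodic := fun a ha => herg a fun s => by
    have := ha (R⁻¹ *ᵥ s)
    rwa [CStarDynamicalSystem.pullback_act, Matrix.mulVec_mulVec, hinvR,
      Matrix.one_mulVec] at this
  have : Nontrivial A := by
    rcases isEmpty_or_nonempty (Fin n) with hn | ⟨⟨k⟩⟩
    · have := nontrivial_of_isEmpty (θ := θ)
      exact hβ.injective.nontrivial
    · by_contra hA
      rw [not_nontrivial_iff_subsingleton] at hA
      -- On the zero algebra everything acts trivially, so a non-integral vector would lie in the
      -- kernel.
      obtain ⟨m, hm⟩ := hkerα (fun _ => 1 / 2) fun a => Subsingleton.elim _ _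
      have h1 : (1 / 2 : ℝ) = m k := congrFun hm k
      have h2 : (1 : ℤ) = 2 * m k := by
        have : (1 : ℝ) = 2 * m k := by linarith
        exact_mod_cast this
      omega
  choose v hv using CStarDynamicalSystem.exists_unitary_isSpectral hα hergα hkerα
  obtain ⟨θ', hθ', hrel⟩ := exists_skew_relations hergα hv
  have hbij := liftPhase_bijective hα hergα hrel hv
  refine ⟨θ', hθ', ?_, ?_⟩
  · have key : ∀ k l, ∃ N : ℤ, (R * θ' * Rᵀ) k l = θ k l + N := fun k l => by
      -- Under `α_s = β_{Rs}` the gauge phase of `u_j` is given by `(R s)_j`, the pairing of row `j`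
      -- of `M` with `s`.
      have hgen : ∀ j, α.IsSpectral (intVec (M j)) (ι (genU θ j : QuantumTorus θ)) := fun j s => by
        rw [CStarDynamicalSystem.pullback_act, hβ.act_eq, isSpectral_genU, map_smul,
          single_one_dotProduct]
        rfl
      have hword : ∀ j, ∃ (w : FreeGroup (Fin n)) (c : ℂ), wordDegree w = M j ∧
          ι (genU θ j : QuantumTorus θ) = c • (FreeGroup.lift v w : A) := fun j => by
        obtain ⟨w, hw⟩ := exists_wordDegree_eq (M j)
        have h1 := lift_isSpectral hv w
        rw [hw] at h1
        obtain ⟨c, hc⟩ := (hgen j).exists_eq_smul hergα _ h1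
        exact ⟨w, c, hw, hc⟩
      obtain ⟨w, c, hw, hc⟩ := hword k
      obtain ⟨w', c', hw', hc'⟩ := hword l
      have hunit : ∀ j, IsUnit (ι (genU θ j : QuantumTorus θ)) := fun j =>
        ((Unitary.toUnits (genU θ j)).isUnit).map ι
      have h1 : ι (genU θ k : QuantumTorus θ) * ι (genU θ l : QuantumTorus θ) =
          (phase (θ k l) : ℂ) •
            (ι (genU θ l : QuantumTorus θ) * ι (genU θ k : QuantumTorus θ)) := by
        rw [← map_mul, genU_mul_genU, map_smul, map_mul]
      -- The scalars `c` and `c'` enter both orders of the product alike, so only the commutation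
      -- phase of the two words remains.
      have h2 : ι (genU θ k : QuantumTorus θ) * ι (genU θ l : QuantumTorus θ) =
          (phase ((R * θ' * Rᵀ) k l) : ℂ) •
            (ι (genU θ l : QuantumTorus θ) * ι (genU θ k : QuantumTorus θ)) := by
        have h3 : (R * θ' * Rᵀ) k l = intVec (M k) ⬝ᵥ θ' *ᵥ intVec (M l) := by
          rw [Matrix.dotProduct_mulVec]
          rfl
        rw [hc, hc', smul_mul_smul_comm, smul_mul_smul_comm, lift_mul_lift hrel, hw, hw', h3,
          smul_comm, mul_comm c]
      have h3 : (phase (θ k l) : ℂ) = phase ((R * θ' * Rᵀ) k l) :=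
        smul_left_injective ℂ ((hunit l).mul (hunit k)).ne_zero (h1.symm.trans h2)
      have h4 : (phase ((R * θ' * Rᵀ) k l - θ k l) : ℂ) = 1 := by
        rw [sub_eq_add_neg, phase_add, ← h3, mul_comm, phase_neg_mul]
      obtain ⟨N, hN⟩ := phase_eq_one_iff.mp h4
      exact ⟨N, by rw [← hN]; ring⟩
    choose N hN using key
    exact ⟨Matrix.of N, by ext k l; exact hN k l⟩
  · let Ψ : QuantumTorus θ' ≃⋆ₐ[ℂ] A := StarAlgEquiv.ofBijective (liftPhase v hrel) hbij
    -- The group isomorphism is `R⁻¹` because `β_s = α_{R⁻¹ s}`.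
    refine ⟨Ψ.symm, Matrix.mulVecContinuousAddEquiv R⁻¹ R hRinv hinvR, fun s a => ?_⟩
    rw [StarAlgEquiv.symm_apply_eq]
    have h := liftPhase_gauge hrel hv (R⁻¹ *ᵥ s) (Ψ.symm a)
    rw [CStarDynamicalSystem.pullback_act, Matrix.mulVec_mulVec, hinvR, Matrix.one_mulVec] at h
    have h5 : liftPhase v hrel (Ψ.symm a) = a := Ψ.apply_symm_apply a
    rw [h5] at h
    exact h.symm
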